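/- For a topological space $Y$ let $\operatorname{ind}(Y)$, $\operatorname{Ind}(Y)$ and $\dim(Y)$ denote its small inductive dimension, its large inductive dimension and its covering dimension (defined by finite open covers and finite open refinements), each equal to $-1$ exactly when $Y=\emptyset$ and possibly $\infty$. Let $\widehat{\operatorname{ind}}(Y)$, $\widehat{\operatorname{Ind}}(Y)$ and $\widehat{\dim}(Y)$ denote the suprema of $\operatorname{ind}(Y')$, $\operatorname{Ind}(Y')$ and $\dim(Y')$, respectively, over all locally compact subsets $Y'\subseteq Y$. A closed subset $L$ of $X$ separates two points $x,y\in X$ if $X\setminus L$ is the union of two disjoint open sets, one containing $x$ and the other containing $y$. Let $D\ge 0$ be an integer and let $X$ be a metric space in which every pair of distinct points can be separated by a closed subset $L\subseteq X$ with $\widehat{\operatorname{ind}}(L)\le D-1$. Then $$\widehat{\operatorname{ind}}(X)=\widehat{\operatorname{Ind}}(X)=\widehat{\dim}(X)\le D .$$ In particular, every locally compact subset of $X$ has small inductive, large inductive and covering dimension at most $D$. -/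

import Mathlib

universe u

/-- `HasLargeInductiveDimensionLT n X`: the large inductive dimension of `X` is less than `n`.
Dimension `< 0` means empty; dimension `< n + 1` means that between any closed set `A` and any
open set `V ⊇ A` there is an open set whose frontier has dimension `< n`. -/
def HasLargeInductiveDimensionLT : ℕ → ∀ (X : Type u) [TopologicalSpace X], Prop
  | 0, X, _ => IsEmpty X
  | n + 1, X, _ => ∀ A V : Set X, IsClosed A → IsOpen V → A ⊆ V →
      ∃ U : Set X, IsOpen U ∧ A ⊆ U ∧ U ⊆ V ∧ HasLargeInductiveDimensionLT n (frontier U)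

/-- The large inductive dimension `Ind X`, where `⊥` stands for `-1` (the empty space) and `⊤`
for infinite dimension, as in Mathlib's `smallInductiveDimension`. -/
noncomputable def largeInductiveDimension (X : Type u) [TopologicalSpace X] : WithBot ℕ∞ :=
  sInf {n | ∀ i : ℕ, n < i → HasLargeInductiveDimensionLT i X}

/-- `HasCoveringDimensionLT n X`: the covering dimension of `X` is less than `n`, i.e. every finite
open cover has a finite open refinement such that every point lies in at most `n` members. -/
def HasCoveringDimensionLT (n : ℕ) (X : Type u) [TopologicalSpace X] : Prop :=
  ∀ 𝒰 : Set (Set X), 𝒰.Finite → (∀ U ∈ 𝒰, IsOpen U) → ⋃₀ 𝒰 = Set.univ →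
    ∃ 𝒱 : Set (Set X), 𝒱.Finite ∧ (∀ V ∈ 𝒱, IsOpen V) ∧ ⋃₀ 𝒱 = Set.univ ∧
      (∀ V ∈ 𝒱, ∃ U ∈ 𝒰, V ⊆ U) ∧ ∀ x : X, {V ∈ 𝒱 | x ∈ V}.encard ≤ n

/-- The covering dimension `dim X`, where `⊥` stands for `-1` (the empty space) and `⊤` for
infinite dimension. -/
noncomputable def coveringDimension (X : Type u) [TopologicalSpace X] : WithBot ℕ∞ :=
  sInf {n | ∀ i : ℕ, n < i → HasCoveringDimensionLT i X}

/-- Supremum of the small inductive dimensions of the locally compact subsets of `X`. -/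
noncomputable def indHat (X : Type u) [TopologicalSpace X] : WithBot ℕ∞ :=
  ⨆ (S : Set X) (_ : LocallyCompactSpace S), smallInductiveDimension S

/-- Supremum of the large inductive dimensions of the locally compact subsets of `X`. -/
noncomputable def largeIndHat (X : Type u) [TopologicalSpace X] : WithBot ℕ∞ :=
  ⨆ (S : Set X) (_ : LocallyCompactSpace S), largeInductiveDimension S

/-- Supremum of the covering dimensions of the locally compact subsets of `X`. -/
noncomputable def dimHat (X : Type u) [TopologicalSpace X] : WithBot ℕ∞ :=
  ⨆ (S : Set X) (_ : LocallyCompactSpace S), coveringDimension S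

/-- The closed set `L` separates `x` from `y` in `X`: the complement of `L` is the union of two
disjoint open sets, one containing `x` and the other `y`. -/
def IsClosedSeparator {X : Type u} [TopologicalSpace X] (L : Set X) (x y : X) : Prop :=
  IsClosed L ∧ ∃ U V : Set X, IsOpen U ∧ IsOpen V ∧ Disjoint U V ∧ U ∪ V = Lᶜ ∧ x ∈ U ∧ y ∈ V

open Set Topology TopologicalSpace

/-! The three hats are compared with a fourth notion: being a union of `n` strongly zero-dimensional
subspaces (Katětov, Urysohn). Such a decomposition bounds `Ind` and `dim` in completely normal
spaces. Conversely, in separable metrizable spaces `ind < n` yields one by splitting off the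
frontiers of a countable basis, and for compact `K` so does `dim K < n`: put countably many
functions to `ℝ` in general position, so that fewer than `n` of them vanish at any point, and sort
the points of `K` by the number of functions vanishing there.

By the countable sum theorem, and because a locally compact metrizable space is a disjoint union of
clopen σ-compact pieces, a decomposition into `n` pieces for every compact subset gives one for
every locally compact subset. Each hat is therefore `< n` exactly when all compact subsets decompose
into `n` pieces, so the hats agree. Finally, in a compact set a point is cut off from the complement
of a neighbourhood by finitely many separators `L`; the resulting open set has its frontier in their
union, which decomposes into `D` pieces, so small inductive dimension is at most `D`. -/

section LocallyConstant

variable {X ι : Type*} [TopologicalSpace X]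

theorem exists_isLocallyConstant_mem [Countable ι] {C : ι → Set X} (hC : ∀ i, IsClopen (C i))
    (hcov : ⋃ i, C i = univ) : ∃ p : X → ι, IsLocallyConstant p ∧ ∀ x, x ∈ C (p x) := by
  classical
  have hmem : ∀ x, ∃ i, x ∈ C i := iUnion_eq_univ_iff.1 hcov
  rcases isEmpty_or_nonempty ι with _ | _
  · have : IsEmpty X := ⟨fun x ↦ isEmptyElim (hmem x).choose⟩
    exact ⟨isEmptyElim, .of_discrete _, isEmptyElim⟩
  obtain ⟨e, he⟩ := exists_surjective_nat ι
  have hfind : ∀ x, ∃ n, x ∈ C (e n) := fun x ↦ he.exists.1 (hmem x)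
  refine ⟨fun x ↦ e (Nat.find (hfind x)), (IsLocallyConstant.iff_eventually_eq _).2 fun x ↦ ?_,
    fun x ↦ Nat.find_spec (hfind x)⟩
  have hlt : ∀ᶠ y in 𝓝 x, ∀ m ∈ Iio (Nat.find (hfind x)), y ∉ C (e m) :=
    (Filter.eventually_all_finite (finite_Iio _)).2 fun m hm ↦
      (hC (e m)).compl.isOpen.mem_nhds (Nat.find_min (hfind x) hm)
  filter_upwards [hlt, (hC _).isOpen.mem_nhds (Nat.find_spec (hfind x))] with y hy hxy
  rw [(Nat.find_eq_iff (hfind y)).2 ⟨hxy, hy⟩]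

theorem isClopen_setOf_mem_of_isLocallyConstant {p : X → ι} (hp : IsLocallyConstant p)
    {C : ι → Set X} (hC : ∀ i, IsClopen (C i)) : IsClopen {x | x ∈ C (p x)} := by
  have hopen (U : ι → Set X) (hU : ∀ i, IsOpen (U i)) : IsOpen {x | x ∈ U (p x)} := by
    refine isOpen_iff_mem_nhds.2 fun x hx ↦ ?_
    filter_upwards [hp.eventually_eq x, (hU _).mem_nhds hx] with y hpy hy
    exact hpy ▸ hy
  exact ⟨⟨hopen (fun i ↦ (C i)ᶜ) fun i ↦ (hC i).compl.isOpen⟩, hopen C fun i ↦ (hC i).isOpen⟩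

end LocallyConstant

/-- Strong zero-dimensionality, i.e. `Ind X ≤ 0`: disjoint closed sets are separated by a clopen
set. No normality or `T₁` axiom is included. -/
def StronglyZeroDimensional (X : Type*) [TopologicalSpace X] : Prop :=
  ∀ A B : Set X, IsClosed A → IsClosed B → Disjoint A B →
    ∃ C : Set X, IsClopen C ∧ A ⊆ C ∧ Disjoint C B

namespace StronglyZeroDimensional

variable {X Y ι : Type*} [TopologicalSpace X] [TopologicalSpace Y]

theorem of_isEmpty [IsEmpty X] : StronglyZeroDimensional X := fun A _ _ _ _ ↦
  ⟨∅, isClopen_empty, (eq_empty_of_isEmpty A).subset, disjoint_bot_left⟩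

theorem normalSpace (h : StronglyZeroDimensional X) : NormalSpace X := ⟨fun A B hA hB hAB ↦
  let ⟨C, hC, hAC, hCB⟩ := h A B hA hB hAB
  ⟨C, Cᶜ, hC.isOpen, hC.compl.isOpen, hAC, subset_compl_iff_disjoint_left.2 hCB,
    disjoint_compl_right⟩⟩

theorem of_isClosedEmbedding (h : StronglyZeroDimensional X) {f : Y → X}
    (hf : IsClosedEmbedding f) : StronglyZeroDimensional Y := by
  intro A B hA hB hAB
  obtain ⟨C, hC, hAC, hCB⟩ := h (f '' A) (f '' B) (hf.isClosedMap _ hA) (hf.isClosedMap _ hB)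
    ((disjoint_image_iff hf.injective).2 hAB)
  exact ⟨f ⁻¹' C, hC.preimage hf.continuous, image_subset_iff.1 hAC,
    disjoint_left.2 fun _ hx hxB ↦ disjoint_left.1 hCB hx (mem_image_of_mem f hxB)⟩

theorem image_iff {f : X → Y} (hf : IsEmbedding f) {Z : Set X} :
    StronglyZeroDimensional (f '' Z) ↔ StronglyZeroDimensional Z :=
  ⟨fun h ↦ h.of_isClosedEmbedding (hf.homeomorphImage Z).isClosedEmbedding,
    fun h ↦ h.of_isClosedEmbedding (hf.homeomorphImage Z).symm.isClosedEmbedding⟩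

theorem preimage_val {Z F : Set X} (h : StronglyZeroDimensional (Z ∩ F : Set X)) :
    StronglyZeroDimensional (Subtype.val ⁻¹' F : Set Z) := by
  rwa [← Subtype.image_preimage_val, image_iff .subtypeVal] at h

theorem isTopologicalBasis_isClopen [T1Space X] (h : StronglyZeroDimensional X) :
    IsTopologicalBasis {C : Set X | IsClopen C} := by
  refine isTopologicalBasis_of_isOpen_of_nhds (fun C hC ↦ hC.isOpen) fun x U hx hU ↦ ?_
  obtain ⟨C, hC, hxC, hCU⟩ := h {x} Uᶜ isClosed_singleton hU.isClosed_compl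
    (disjoint_compl_right_iff_subset.2 (singleton_subset_iff.2 hx))
  exact ⟨C, hC, singleton_subset_iff.1 hxC, disjoint_compl_right_iff_subset.1 hCU⟩

theorem of_isTopologicalBasis_isClopen [LindelofSpace X]
    (h : IsTopologicalBasis {C : Set X | IsClopen C}) : StronglyZeroDimensional X := by
  intro A B hA hB hAB
  have hsep (x : X) : ∃ C : Set X, IsClopen C ∧ x ∈ C ∧ (Disjoint C A ∨ Disjoint C B) := by
    by_cases hx : x ∈ A
    · obtain ⟨C, hC, hxC, hCB⟩ := h.exists_subset_of_mem_open (disjoint_left.1 hAB hx)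
        hB.isOpen_compl
      exact ⟨C, hC, hxC, .inr (disjoint_left.2 hCB)⟩
    · obtain ⟨C, hC, hxC, hCA⟩ := h.exists_subset_of_mem_open hx hA.isOpen_compl
      exact ⟨C, hC, hxC, .inl (disjoint_left.2 hCA)⟩
  choose C hC hxC hCAB using hsep
  obtain ⟨t, ht, htcov⟩ := countable_cover_nhds fun x ↦ (hC x).isOpen.mem_nhds (hxC x)
  have := ht.to_subtype
  obtain ⟨p, hp, hpC⟩ := exists_isLocallyConstant_mem (C := fun i : t ↦ C i) (fun i ↦ hC i)
    (by rw [← htcov, biUnion_eq_iUnion])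
  refine ⟨p ⁻¹' {i | Disjoint (C i) B}, ⟨⟨hp {i | Disjoint (C i) B}ᶜ⟩, hp _⟩, fun x hx ↦ ?_,
    disjoint_left.2 fun x hx ↦ disjoint_left.1 hx (hpC x)⟩
  exact (hCAB (p x)).resolve_left fun hdisj ↦ disjoint_left.1 hdisj (hpC x) hx

theorem of_isEmbedding [T1Space X] [LindelofSpace Y] (h : StronglyZeroDimensional X) {f : Y → X}
    (hf : IsEmbedding f) : StronglyZeroDimensional Y := by
  refine of_isTopologicalBasis_isClopen (IsTopologicalBasis.of_isOpen_of_subset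
    (fun C hC ↦ hC.isOpen) (h.isTopologicalBasis_isClopen.isInducing hf.isInducing) ?_)
  rintro _ ⟨C, hC, rfl⟩
  exact IsClopen.preimage hC hf.continuous

theorem mono [T1Space X] [HereditarilyLindelofSpace X] {Z W : Set X}
    (h : StronglyZeroDimensional Z) (hWZ : W ⊆ Z) : StronglyZeroDimensional W :=
  h.of_isEmbedding (IsEmbedding.inclusion hWZ)

theorem of_isLocallyConstant {p : X → ι} (hp : IsLocallyConstant p)
    (h : ∀ i, StronglyZeroDimensional (p ⁻¹' {i})) : StronglyZeroDimensional X := by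
  intro A B hA hB hAB
  choose C hC hAC hCB using fun i ↦ h i (Subtype.val ⁻¹' A) (Subtype.val ⁻¹' B)
    (hA.preimage continuous_subtype_val) (hB.preimage continuous_subtype_val) (hAB.preimage _)
  have hclopen (i : ι) : IsClopen (Subtype.val '' C i) :=
    ⟨(hp.isClosed_fiber i).isClosedMap_subtype_val _ (hC i).isClosed,
      (hp.isOpen_fiber i).isOpenMap_subtype_val _ (hC i).isOpen⟩
  refine ⟨_, isClopen_setOf_mem_of_isLocallyConstant hp hclopen,
    fun x hx ↦ mem_image_of_mem _ (hAC (p x) (a := ⟨x, rfl⟩) hx), disjoint_left.2 ?_⟩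
  rintro x ⟨y, hy, hyx⟩ hxB
  exact disjoint_left.1 (hCB _) hy (by rwa [mem_preimage, hyx])



theorem exists_isClosed_subset_union {F P Q : Set X} (h : StronglyZeroDimensional F)
    (hF : IsClosed F) (hP : IsClosed P) (hQ : IsClosed Q) (hPQ : Disjoint P Q) :
    ∃ P' Q' : Set X, IsClosed P' ∧ IsClosed Q' ∧ Disjoint P' Q' ∧ P ⊆ P' ∧ Q ⊆ Q' ∧
      F ⊆ P' ∪ Q' := by
  obtain ⟨C, hC, hPC, hCQ⟩ := h (Subtype.val ⁻¹' P) (Subtype.val ⁻¹' Q)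
    (hP.preimage continuous_subtype_val) (hQ.preimage continuous_subtype_val) (hPQ.preimage _)
  refine ⟨P ∪ Subtype.val '' C, Q ∪ Subtype.val '' Cᶜ,
    hP.union (hF.isClosedMap_subtype_val _ hC.isClosed),
    hQ.union (hF.isClosedMap_subtype_val _ hC.compl.isClosed),
    disjoint_union_left.2 ⟨disjoint_union_right.2 ⟨hPQ, ?_⟩, disjoint_union_right.2 ⟨?_, ?_⟩⟩,
    subset_union_left, subset_union_left, fun x hx ↦ ?_⟩
  · exact disjoint_left.2 fun x hxP ⟨y, hy, hyx⟩ ↦ hy (hPC (by rwa [mem_preimage, hyx]))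
  · exact disjoint_left.2 fun x ⟨y, hy, hyx⟩ hxQ ↦
      disjoint_left.1 hCQ hy (by rwa [mem_preimage, hyx])
  · exact (disjoint_image_iff Subtype.val_injective).2 disjoint_compl_right
  · by_cases hxC : (⟨x, hx⟩ : F) ∈ C
    exacts [.inl (.inr ⟨_, hxC, rfl⟩), .inr (.inr ⟨_, hxC, rfl⟩)]

theorem exists_isClosed_nhds_subset_union [NormalSpace X] {F P Q : Set X}
    (h : StronglyZeroDimensional F) (hF : IsClosed F) (hP : IsClosed P) (hQ : IsClosed Q)
    (hPQ : Disjoint P Q) :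
    ∃ P' Q' : Set X, (IsClosed P' ∧ IsClosed Q' ∧ Disjoint P' Q') ∧ P ⊆ interior P' ∧
      Q ⊆ interior Q' ∧ F ⊆ interior P' ∪ interior Q' := by
  obtain ⟨P₁, Q₁, hP₁, hQ₁, hPQ₁, hPP₁, hQQ₁, hFPQ₁⟩ :=
    h.exists_isClosed_subset_union hF hP hQ hPQ
  obtain ⟨U, hU, hPU, hUQ⟩ := normal_exists_closure_subset hP₁ hQ₁.isOpen_compl
    (disjoint_left.1 hPQ₁)
  obtain ⟨V, hV, hQV, hVU⟩ := normal_exists_closure_subset hQ₁ isClosed_closure.isOpen_compl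
    (subset_compl_comm.1 hUQ)
  have hP₁U : P₁ ⊆ interior (closure U) := hPU.trans (interior_maximal subset_closure hU)
  have hQ₁V : Q₁ ⊆ interior (closure V) := hQV.trans (interior_maximal subset_closure hV)
  exact ⟨closure U, closure V, ⟨isClosed_closure, isClosed_closure, (disjoint_left.2 hVU).symm⟩,
    hPP₁.trans hP₁U, hQQ₁.trans hQ₁V, hFPQ₁.trans (union_subset_union hP₁U hQ₁V)⟩

/-- Starting from `(A, B)`, enlarge a disjoint closed pair step by step so that the `n`-th step
covers `F n`; taking closed neighbourhoods each time makes the two unions open. -/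
theorem of_iUnion_nat [NormalSpace X] {F : ℕ → Set X} (hF : ∀ n, IsClosed (F n))
    (hcov : ⋃ n, F n = univ) (h : ∀ n, StronglyZeroDimensional (F n)) :
    StronglyZeroDimensional X := by
  intro A B hA hB hAB
  let T := {p : Set X × Set X // IsClosed p.1 ∧ IsClosed p.2 ∧ Disjoint p.1 p.2}
  have step (n : ℕ) (p : T) : ∃ q : T, p.1.1 ⊆ interior q.1.1 ∧ p.1.2 ⊆ interior q.1.2 ∧
      F n ⊆ interior q.1.1 ∪ interior q.1.2 :=
    let ⟨P, Q, hPQ, hq⟩ := (h n).exists_isClosed_nhds_subset_union (hF n) p.2.1 p.2.2.1 p.2.2.2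
    ⟨⟨(P, Q), hPQ⟩, hq⟩
  choose next hleft hright hunion using step
  let s : ℕ → T := fun n ↦ Nat.rec ⟨(A, B), hA, hB, hAB⟩ next n
  have hmonoLeft : Monotone fun n ↦ (s n).1.1 :=
    monotone_nat_of_le_succ fun n ↦ (hleft n (s n)).trans interior_subset
  have hmonoRight : Monotone fun n ↦ (s n).1.2 :=
    monotone_nat_of_le_succ fun n ↦ (hright n (s n)).trans interior_subset
  have hdisj : Disjoint (⋃ n, interior (s n).1.1) (⋃ n, interior (s n).1.2) := by
    simp only [disjoint_iUnion_left, disjoint_iUnion_right]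
    exact fun n m ↦ (s (max m n)).2.2.2.mono
      (interior_subset.trans (hmonoLeft (le_max_left m n)))
      (interior_subset.trans (hmonoRight (le_max_right m n)))
  have hcover : univ ⊆ (⋃ n, interior (s n).1.1) ∪ ⋃ n, interior (s n).1.2 := by
    rw [← hcov, ← iUnion_union_distrib]
    exact iUnion_subset fun n ↦ (hunion n (s n)).trans
      (subset_iUnion (fun n ↦ interior (s n).1.1 ∪ interior (s n).1.2) (n + 1))
  exact ⟨⋃ n, interior (s n).1.1,
    isClopen_of_disjoint_cover_open hcover (isOpen_iUnion fun _ ↦ isOpen_interior)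
      (isOpen_iUnion fun _ ↦ isOpen_interior) hdisj,
    (hleft 0 (s 0)).trans (subset_iUnion (fun n ↦ interior (s n).1.1) 1),
    hdisj.mono_right ((hright 0 (s 0)).trans (subset_iUnion (fun n ↦ interior (s n).1.2) 1))⟩

theorem of_iUnion [Countable ι] [NormalSpace X] {F : ι → Set X} (hF : ∀ i, IsClosed (F i))
    (hcov : ⋃ i, F i = univ) (h : ∀ i, StronglyZeroDimensional (F i)) :
    StronglyZeroDimensional X := by
  rcases isEmpty_or_nonempty ι with _ | _
  · have : IsEmpty X := univ_eq_empty_iff.1 (hcov ▸ iUnion_of_empty F)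
    exact of_isEmpty
  · obtain ⟨e, he⟩ := exists_surjective_nat ι
    exact of_iUnion_nat (fun n ↦ hF (e n)) (by rw [← hcov, he.iUnion_comp F]) fun n ↦ h (e n)

theorem of_subset_iUnion [Countable ι] {Z : Set X} [NormalSpace Z] {F : ι → Set X}
    (hF : ∀ i, IsClosed (F i)) (hcov : Z ⊆ ⋃ i, F i)
    (h : ∀ i, StronglyZeroDimensional (Z ∩ F i : Set X)) : StronglyZeroDimensional Z :=
  of_iUnion (fun i ↦ (hF i).preimage continuous_subtype_val)
    (by rwa [← preimage_iUnion, preimage_eq_univ_iff, Subtype.range_val]) fun i ↦ (h i).preimage_val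

end StronglyZeroDimensional

section Separation

variable {X ι : Type*} [TopologicalSpace X]

theorem disjoint_closure_image_val_compl {Z : Set X} {C : Set Z} (hC : IsClosed C) :
    Disjoint (closure (Subtype.val '' C)) (Subtype.val '' Cᶜ : Set X) := by
  rw [disjoint_left]
  rintro _ hx ⟨y, hy, rfl⟩
  rw [← hC.closure_eq, IsEmbedding.subtypeVal.closure_eq_preimage_closure_image] at hy
  exact hy hx

theorem StronglyZeroDimensional.exists_isLocallyConstant_mem [Finite ι]
    (h : StronglyZeroDimensional X) {U : ι → Set X} (hU : ∀ i, IsOpen (U i))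
    (hcov : ⋃ i, U i = univ) : ∃ p : X → ι, IsLocallyConstant p ∧ ∀ x, x ∈ U (p x) := by
  have := h.normalSpace
  obtain ⟨v, hvcov, hv, hvU⟩ := exists_iUnion_eq_closed_subset hU (fun _ ↦ toFinite _) hcov
  choose C hC hvC hCU using fun i ↦ h (v i) (U i)ᶜ (hv i) (hU i).isClosed_compl
    (disjoint_compl_right_iff_subset.2 (hvU i))
  obtain ⟨p, hp, hpC⟩ := _root_.exists_isLocallyConstant_mem hC
    (univ_subset_iff.1 (hvcov ▸ iUnion_mono hvC))
  exact ⟨p, hp, fun x ↦ disjoint_compl_right_iff_subset.1 (hCU _) (hpC x)⟩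

variable [CompletelyNormalSpace X]

theorem separatedNhds_image_val_compl {Z : Set X} {C : Set Z} (hC : IsClopen C) :
    SeparatedNhds (Subtype.val '' C : Set X) (Subtype.val '' Cᶜ) :=
  separatedNhds_iff_disjoint.2 <| completely_normal (disjoint_closure_image_val_compl hC.isClosed)
    (by simpa only [compl_compl] using (disjoint_closure_image_val_compl hC.compl.isClosed).symm)

namespace StronglyZeroDimensional

theorem exists_isOpen_disjoint_frontier {Z A V : Set X} (h : StronglyZeroDimensional Z)
    (hA : IsClosed A) (hV : IsOpen V) (hAV : A ⊆ V) :
    ∃ U, IsOpen U ∧ A ⊆ U ∧ U ⊆ V ∧ Disjoint (frontier U) Z := by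
  obtain ⟨U₁, hU₁, hAU₁, hU₁V⟩ := normal_exists_closure_subset hA hV hAV
  obtain ⟨V₁, hV₁, hVV₁, hV₁U₁⟩ := normal_exists_closure_subset hV.isClosed_compl
    isClosed_closure.isOpen_compl (compl_subset_compl.2 hU₁V)
  have hUV₁ : Disjoint (closure U₁) (closure V₁) := (disjoint_left.2 hV₁U₁).symm
  obtain ⟨C, hC, hUC, hCV⟩ := h (Subtype.val ⁻¹' closure U₁) (Subtype.val ⁻¹' closure V₁)
    (isClosed_closure.preimage continuous_subtype_val)
    (isClosed_closure.preimage continuous_subtype_val) (hUV₁.preimage _)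
  have hAV₁ : SeparatedNhds A Vᶜ :=
    ⟨U₁, V₁, hU₁, hV₁, hAU₁, hVV₁, hUV₁.mono subset_closure subset_closure⟩
  have hAC : SeparatedNhds A (Subtype.val '' Cᶜ) :=
    ⟨U₁, (closure U₁)ᶜ, hU₁, isClosed_closure.isOpen_compl, hAU₁,
      image_subset_iff.2 (compl_subset_compl.2 hUC), disjoint_compl_right.mono_left subset_closure⟩
  have hVC : SeparatedNhds (Subtype.val '' C) Vᶜ :=
    ⟨(closure V₁)ᶜ, V₁, isClosed_closure.isOpen_compl, hV₁,
      image_subset_iff.2 (subset_compl_iff_disjoint_right.2 hCV), hVV₁,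
      disjoint_compl_left.mono_right subset_closure⟩
  obtain ⟨U, W, hU, hW, hACU, hVCW, hUW⟩ :=
    (hAV₁.union_left hVC).union_right (hAC.union_left (separatedNhds_image_val_compl hC))
  refine ⟨U, hU, subset_union_left.trans hACU,
    compl_subset_compl.1 ((subset_union_left.trans hVCW).trans
      (subset_compl_iff_disjoint_left.2 hUW)), disjoint_left.2 fun x hx hxZ ↦ ?_⟩
  rw [hU.frontier_eq] at hx
  by_cases hxC : (⟨x, hxZ⟩ : Z) ∈ C
  · exact hx.2 (hACU (.inr ⟨_, hxC, rfl⟩))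
  · exact disjoint_left.1 (hUW.closure_left hW) hx.1 (hVCW (.inr ⟨_, hxC, rfl⟩))

theorem exists_disjoint_isOpen_refinement [Finite ι] {Z : Set X} (h : StronglyZeroDimensional Z)
    {U : ι → Set X} (hU : ∀ i, IsOpen (U i)) (hZU : Z ⊆ ⋃ i, U i) :
    ∃ V : ι → Set X, (∀ i, IsOpen (V i)) ∧ (∀ i, V i ⊆ U i) ∧ Z ⊆ ⋃ i, V i ∧
      Pairwise (Function.onFun Disjoint V) := by
  obtain ⟨p, hp, hpU⟩ := h.exists_isLocallyConstant_mem
    (fun i ↦ (hU i).preimage continuous_subtype_val)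
    (by rwa [← preimage_iUnion, preimage_eq_univ_iff, Subtype.range_val])
  choose G H hG hH hpG hpH hGH using fun i ↦
    separatedNhds_image_val_compl (hp.isClopen_fiber i)
  refine ⟨fun i ↦ U i ∩ G i ∩ ⋂ j ∈ {j | j ≠ i}, H j,
    fun i ↦ ((hU i).inter (hG i)).inter (toFinite _ |>.isOpen_biInter fun j _ ↦ hH j),
    fun i ↦ inter_subset_left.trans inter_subset_left, fun x hx ↦ ?_, fun i j hij ↦ ?_⟩
  · refine mem_iUnion.2 ⟨p ⟨x, hx⟩, ⟨hpU ⟨x, hx⟩, hpG _ ⟨_, rfl, rfl⟩⟩, mem_iInter₂.2 ?_⟩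
    exact fun j hj ↦ hpH j ⟨⟨x, hx⟩, fun hpx ↦ hj hpx.symm, rfl⟩
  · exact (hGH i).mono (inter_subset_left.trans inter_subset_right)
      (inter_subset_right.trans (biInter_subset_of_mem hij))

end StronglyZeroDimensional

end Separation

/-- Each `F i` minus the finitely many earlier ones is an `Fσ`, since open sets are. -/
theorem exists_isClosed_refinement_disjoint {X ι : Type*} [TopologicalSpace X] [MetrizableSpace X]
    [Countable ι] {F : ι → Set X} (hF : ∀ i, IsClosed (F i)) : ∃ D : ι → ℕ → Set X,
      (∀ i k, IsClosed (D i k)) ∧ (∀ i k, D i k ⊆ F i) ∧ ⋃ i, F i ⊆ ⋃ i, ⋃ k, D i k ∧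
      Pairwise fun i j ↦ Disjoint (⋃ k, D i k) (⋃ k, D j k) := by
  let := metrizableSpaceMetric X
  obtain ⟨e, he⟩ := exists_injective_nat ι
  have hopen (i : ι) : IsOpen (⋃ j ∈ e ⁻¹' Iio (e i), F j)ᶜ :=
    (((finite_Iio (e i)).preimage he.injOn).isClosed_biUnion fun j _ ↦ hF j).isOpen_compl
  choose G hG _ hGcov _ using fun i ↦ (hopen i).exists_iUnion_isClosed
  have hmem {x : X} {i : ι} :
      x ∈ ⋃ k, F i ∩ G i k ↔ x ∈ F i ∧ ∀ j, e j < e i → x ∉ F j := by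
    rw [← inter_iUnion, hGcov]
    simp only [mem_inter_iff, mem_compl_iff, mem_iUnion, mem_preimage, mem_Iio, exists_prop,
      not_exists, not_and]
  refine ⟨fun i k ↦ F i ∩ G i k, fun i k ↦ (hF i).inter (hG i k), fun i k ↦ inter_subset_left,
    fun x hx ↦ ?_, fun i j hij ↦ disjoint_left.2 fun x hxi hxj ↦ ?_⟩
  · obtain ⟨i, hi, hmin⟩ := (measure e).wf.has_min {i | x ∈ F i} (mem_iUnion.1 hx)
    exact mem_iUnion.2 ⟨i, hmem.2 ⟨hi, fun j hj hjx ↦ hmin j hjx hj⟩⟩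
  · rw [hmem] at hxi hxj
    rcases lt_or_gt_of_ne (he.ne hij) with hlt | hlt
    exacts [hxj.2 i hlt hxi.1, hxi.2 j hlt hxj.1]

/-! ### Covers by zero-dimensional subspaces -/

/-- `X` is the union of `n` strongly zero-dimensional subspaces. For separable metrizable `X` this
characterizes dimension less than `n`; it is the notion through which the three dimension functions
are compared. The subspaces may be empty and need not be disjoint. -/
def HasZeroDimensionalCover (n : ℕ) (X : Type*) [TopologicalSpace X] : Prop :=
  ∃ Z : Fin n → Set X, (∀ i, StronglyZeroDimensional (Z i)) ∧ ⋃ i, Z i = univ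

namespace HasZeroDimensionalCover

variable {X Y ι : Type*} [TopologicalSpace X] [TopologicalSpace Y] {n : ℕ}

theorem succ {W : Set X} (h : HasZeroDimensionalCover n W) (hW : StronglyZeroDimensional ↥Wᶜ) :
    HasZeroDimensionalCover (n + 1) X := by
  obtain ⟨Z, hZ, hcov⟩ := h
  refine ⟨Fin.cons Wᶜ fun i ↦ Subtype.val '' Z i,
    Fin.cases hW fun i ↦ (StronglyZeroDimensional.image_iff .subtypeVal).2 (hZ i),
    iUnion_eq_univ_iff.2 fun x ↦ ?_⟩
  by_cases hx : x ∈ W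
  · obtain ⟨i, hi⟩ := iUnion_eq_univ_iff.1 hcov ⟨x, hx⟩
    exact ⟨i.succ, _, hi, rfl⟩
  · exact ⟨0, hx⟩

theorem of_isEmbedding [T1Space X] [HereditarilyLindelofSpace Y]
    (h : HasZeroDimensionalCover n X) {f : Y → X} (hf : IsEmbedding f) :
    HasZeroDimensionalCover n Y :=
  let ⟨Z, hZ, hcov⟩ := h
  ⟨fun i ↦ f ⁻¹' Z i, fun i ↦ (hZ i).of_isEmbedding (hf.restrictPreimage (Z i)),
    by rw [← preimage_iUnion, hcov, preimage_univ]⟩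

section SecondCountable

variable [T3Space X] [SecondCountableTopology X]

theorem of_iUnion [Countable ι] {F : ι → Set X} (hF : ∀ i, IsClosed (F i))
    (hcov : ⋃ i, F i = univ) (h : ∀ i, HasZeroDimensionalCover n (F i)) :
    HasZeroDimensionalCover n X := by
  choose Z hZ hZcov using h
  obtain ⟨D, hD, hDF, hFD, hDdisj⟩ := exists_isClosed_refinement_disjoint hF
  have hDcov : ⋃ i, ⋃ k, D i k = univ := univ_subset_iff.1 (hcov ▸ hFD)
  refine ⟨fun j ↦ ⋃ i, Subtype.val '' Z i j ∩ ⋃ k, D i k, fun j ↦ ?_,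
    eq_univ_of_forall fun x ↦ ?_⟩
  · refine .of_subset_iUnion (F := fun p : ι × ℕ ↦ D p.1 p.2) (fun p ↦ hD p.1 p.2)
      (by rw [iUnion_prod', hDcov]; exact subset_univ _) fun ⟨i, k⟩ ↦ ?_
    refine ((StronglyZeroDimensional.image_iff .subtypeVal).2 (hZ i j)).mono ?_
    rintro x ⟨hx, hxD⟩
    obtain ⟨i', hxZ, hxD'⟩ := mem_iUnion.1 hx
    obtain rfl : i' = i := by_contra fun hne ↦
      disjoint_left.1 (hDdisj hne) hxD' (mem_iUnion.2 ⟨k, hxD⟩)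
    exact hxZ
  · obtain ⟨i, hxD⟩ := iUnion_eq_univ_iff.1 hDcov x
    obtain ⟨k, hk⟩ := mem_iUnion.1 hxD
    obtain ⟨j, hj⟩ := iUnion_eq_univ_iff.1 (hZcov i) ⟨x, hDF i k hk⟩
    exact mem_iUnion.2 ⟨j, mem_iUnion.2 ⟨i, ⟨_, hj, rfl⟩, hxD⟩⟩

theorem of_subset_iUnion [Countable ι] {W : Set X} {F : ι → Set X} (hF : ∀ i, IsClosed (F i))
    (hcov : W ⊆ ⋃ i, F i) (h : ∀ i, HasZeroDimensionalCover n (F i)) :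
    HasZeroDimensionalCover n W :=
  of_iUnion (fun i ↦ (hF i).preimage continuous_subtype_val)
    (by rwa [← preimage_iUnion, preimage_eq_univ_iff, Subtype.range_val])
    fun i ↦ (h i).of_isEmbedding (IsEmbedding.subtypeVal.restrictPreimage (F i))

end SecondCountable

theorem hasLargeInductiveDimensionLT {X : Type u} [TopologicalSpace X] [CompletelyNormalSpace X]
    (h : HasZeroDimensionalCover n X) : HasLargeInductiveDimensionLT n X := by
  induction n generalizing X with
  | zero =>
    obtain ⟨Z, -, hcov⟩ := h
    exact univ_eq_empty_iff.1 (hcov ▸ iUnion_of_empty Z)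
  | succ n ih =>
    obtain ⟨Z, hZ, hcov⟩ := h
    intro A V hA hV hAV
    obtain ⟨U, hU, hAU, hUV, hUZ⟩ := (hZ 0).exists_isOpen_disjoint_frontier hA hV hAV
    refine ⟨U, hU, hAU, hUV, ih ⟨fun i ↦ Subtype.val ⁻¹' Z i.succ,
      fun i ↦ (hZ _).of_isClosedEmbedding
        (isClosed_frontier.isClosedEmbedding_subtypeVal.restrictPreimage _),
      iUnion_eq_univ_iff.2 fun x ↦ ?_⟩⟩
    obtain ⟨i, hi⟩ := iUnion_eq_univ_iff.1 hcov x
    cases i using Fin.cases with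
    | zero => exact (disjoint_left.1 hUZ x.2 hi).elim
    | succ i => exact ⟨i, hi⟩

theorem hasCoveringDimensionLT {X : Type u} [TopologicalSpace X] [CompletelyNormalSpace X]
    (h : HasZeroDimensionalCover n X) : HasCoveringDimensionLT n X := by
  intro 𝒰 hfin hopen hcov
  obtain ⟨Z, hZ, hZcov⟩ := h
  have := hfin.to_subtype
  choose V hV hVU hZV hVdisj using fun j ↦ (hZ j).exists_disjoint_isOpen_refinement
    (U := fun U : 𝒰 ↦ U) (fun U ↦ hopen U U.2)
    (by rw [← sUnion_eq_iUnion, hcov]; exact subset_univ _)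
  refine ⟨range fun p : Fin n × 𝒰 ↦ V p.1 p.2, finite_range _, ?_,
    eq_univ_of_forall fun x ↦ ?_, ?_, fun x ↦ ?_⟩
  · exact forall_mem_range.2 fun p ↦ hV p.1 p.2
  · obtain ⟨j, hj⟩ := iUnion_eq_univ_iff.1 hZcov x
    obtain ⟨U, hU⟩ := mem_iUnion.1 (hZV j hj)
    exact ⟨V j U, ⟨(j, U), rfl⟩, hU⟩
  · exact forall_mem_range.2 fun p ↦ ⟨p.2, p.2.2, hVU p.1 p.2⟩
  · have hmem (W : {W ∈ range fun p : Fin n × 𝒰 ↦ V p.1 p.2 | x ∈ W}) :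
        ∃ j U, V j U = W ∧ x ∈ V j U :=
      let ⟨p, hp⟩ := W.2.1
      ⟨p.1, p.2, hp, hp.symm.subset W.2.2⟩
    choose j U hVW hxV using hmem
    have hinj : Function.Injective j := fun W W' hWW' ↦ by
      have hUU' : U W = U W' := by_contra fun hne ↦
        disjoint_left.1 (hVdisj (j W) hne) (hxV W) (hWW' ▸ hxV W')
      rw [Subtype.ext_iff, ← hVW W, ← hVW W', hWW', hUU']
    simpa using ENat.card_le_card_of_injective hinj

theorem of_hasSmallInductiveDimensionLT {X : Type*} [TopologicalSpace X] [T3Space X]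
    [SecondCountableTopology X] (h : HasSmallInductiveDimensionLT X n) :
    HasZeroDimensionalCover n X := by
  induction n generalizing X with
  | zero =>
    have := hasSmallInductiveDimensionLT_zero_iff.1 h
    exact ⟨fun _ ↦ ∅, fun _ ↦ .of_isEmpty, Subsingleton.elim _ _⟩
  | succ n ih =>
    cases h with | succ _ s hs hfrontierLT
    obtain ⟨t, hts, ht, htbasis⟩ := hs.exists_countable
    have := ht.to_subtype
    have hfrontier : HasZeroDimensionalCover n (⋃ U : t, frontier (U : Set _) : Set _) :=
      .of_subset_iUnion (F := fun U : t ↦ frontier (U : Set X)) (fun _ ↦ isClosed_frontier)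
        Subset.rfl fun U ↦ ih (hfrontierLT U (hts U.2))
    refine hfrontier.succ (.of_isTopologicalBasis_isClopen (IsTopologicalBasis.of_isOpen_of_subset
      (fun C hC ↦ hC.isOpen) (htbasis.isInducing IsInducing.subtypeVal) ?_))
    rintro _ ⟨U, hU, rfl⟩
    refine isClopen_iff_frontier_eq_empty.2 (eq_empty_of_forall_notMem fun x hx ↦ x.2 ?_)
    exact mem_iUnion.2 ⟨⟨U, hU⟩, continuous_subtype_val.frontier_preimage_subset U hx⟩

end HasZeroDimensionalCover

theorem HasLargeInductiveDimensionLT.hasSmallInductiveDimensionLT {X : Type u}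
    [TopologicalSpace X] [T1Space X] {n : ℕ} (h : HasLargeInductiveDimensionLT n X) :
    HasSmallInductiveDimensionLT X n := by
  induction n generalizing X with
  | zero => exact hasSmallInductiveDimensionLT_zero_iff.2 h
  | succ n ih =>
    refine .succ n {U | IsOpen U ∧ HasSmallInductiveDimensionLT (frontier U) n}
      (isTopologicalBasis_of_isOpen_of_nhds (fun U hU ↦ hU.1) fun x V hx hV ↦ ?_) fun U hU ↦ hU.2
    obtain ⟨U, hU, hxU, hUV, hfrontier⟩ :=
      h {x} V isClosed_singleton hV (singleton_subset_iff.2 hx)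
    exact ⟨U, ⟨hU, ih hfrontier⟩, singleton_subset_iff.1 hxU, hUV⟩

/-! ### General position and the covering dimension -/

section GeneralPosition

theorem dense_iInter_compl_submodule {E κ : Type*} [NormedAddCommGroup E] [NormedSpace ℝ E]
    [BaireSpace E] [Countable κ] {V : κ → Submodule ℝ E} (hV : ∀ i, IsClosed (V i : Set E))
    (hVtop : ∀ i, V i ≠ ⊤) : Dense (⋂ i, (V i : Set E)ᶜ) := by
  refine dense_iInter_of_isOpen (fun i ↦ (hV i).isOpen_compl) fun i ↦ ?_
  rw [← interior_eq_empty_iff_dense_compl, ← not_nonempty_iff_eq_empty]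
  exact fun h ↦ hVtop i (Submodule.eq_top_of_nonempty_interior' _ h)

variable {E ι : Type*} [NormedAddCommGroup E] [NormedSpace ℝ E] [FiniteDimensional ℝ E]

theorem exists_dist_lt_forall_notMem_span [Countable ι] (p : ι → E) (v : E) {δ : ℝ}
    (hδ : 0 < δ) : ∃ w, dist w v < δ ∧ ∀ t : Finset ι, t.card < Module.finrank ℝ E →
      w ∉ Submodule.span ℝ (p '' t) := by
  classical
  have hspan (t : {t : Finset ι // t.card < Module.finrank ℝ E}) :
      Submodule.span ℝ (p '' t.1) ≠ ⊤ := by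
    intro htop
    have hcard : Module.finrank ℝ (Submodule.span ℝ (p '' t.1)) ≤ t.1.card := by
      rw [← Finset.coe_image]
      exact (finrank_span_finset_le_card _).trans Finset.card_image_le
    rw [htop, finrank_top] at hcard
    exact hcard.not_gt t.2
  have := FiniteDimensional.complete ℝ E
  obtain ⟨w, hw, hwspan⟩ := Metric.dense_iff.1
    (dense_iInter_compl_submodule (fun t ↦ Submodule.closed_of_finiteDimensional _) hspan) v δ hδ
  exact ⟨w, hw, fun t ht ↦ mem_iInter.1 hwspan ⟨t, ht⟩⟩

theorem exists_dist_lt_linearIndepOn [Countable ι] (q : ι → E) {δ : ℝ} (hδ : 0 < δ)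
    (s : Finset ι) : ∃ p : ι → E, (∀ i, dist (p i) (q i) < δ) ∧
      ∀ t ⊆ s, t.card ≤ Module.finrank ℝ E → LinearIndepOn ℝ p (t : Set ι) := by
  classical
  induction s using Finset.induction_on with
  | empty =>
    refine ⟨q, fun i ↦ by simpa using hδ, fun t ht _ ↦ ?_⟩
    rw [Finset.subset_empty.1 ht, Finset.coe_empty]
    exact linearIndepOn_empty ℝ q
  | insert a s ha ih =>
    obtain ⟨p, hpq, hp⟩ := ih
    obtain ⟨w, hwq, hw⟩ := exists_dist_lt_forall_notMem_span p (q a) hδ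
    have hagree {t : Finset ι} (ht : t ⊆ s) : EqOn p (Function.update p a w) t := fun i hi ↦
      (Function.update_of_ne (ne_of_mem_of_not_mem (ht hi) ha) _ _).symm
    refine ⟨Function.update p a w,
      (Function.forall_update_iff p fun i v ↦ dist v (q i) < δ).2 ⟨hwq, fun i _ ↦ hpq i⟩,
      fun t ht hcard ↦ ?_⟩
    by_cases hat : a ∈ t
    · have hts : t.erase a ⊆ s := Finset.subset_insert_iff.1 ht
      have hcard' : (t.erase a).card < Module.finrank ℝ E :=
        (Finset.card_erase_lt_of_mem hat).trans_le hcard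
      rw [← Finset.insert_erase hat, Finset.coe_insert]
      refine ((hp _ hts hcard'.le).congr (hagree hts)).insert ?_
      rw [← (hagree hts).image_eq, Function.update_self]
      exact hw _ hcard'
    · have hts : t ⊆ s := (Finset.subset_insert_iff_of_notMem hat).1 ht
      exact (hp t hts hcard).congr (hagree hts)

end GeneralPosition

section CoveringDimension

variable {K : Type u} [TopologicalSpace K] [CompactSpace K] [T2Space K] {n : ℕ}

namespace HasCoveringDimensionLT

theorem exists_partitionOfUnity {E : Type*} [PseudoMetricSpace E]
    (h : HasCoveringDimensionLT n K) (g : C(K, E)) {ε : ℝ} (hε : 0 < ε) :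
    ∃ (ι : Type u) (_ : Finite ι) (φ : PartitionOfUnity ι K) (q : ι → E),
      (∀ i x, φ i x ≠ 0 → dist (q i) (g x) < ε) ∧ ∀ x, {i | φ i x ≠ 0}.encard ≤ n := by
  have hopen (x : K) : IsOpen (g ⁻¹' Metric.ball (g x) ε) :=
    Metric.isOpen_ball.preimage g.continuous
  obtain ⟨t, ht⟩ := CompactSpace.elim_nhds_subcover _ fun x : K ↦
    (hopen x).mem_nhds (Metric.mem_ball_self hε)
  obtain ⟨𝒱, hfin, hVopen, hVcov, hVt, hcard⟩ := h _
    (t.finite_toSet.image fun x ↦ g ⁻¹' Metric.ball (g x) ε)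
    (forall_mem_image.2 fun x _ ↦ hopen x) (by rw [sUnion_image]; exact ht)
  have hcenter (V : 𝒱) : ∃ x : K, (V : Set K) ⊆ g ⁻¹' Metric.ball (g x) ε :=
    let ⟨_, ⟨x, _, hx⟩, hV⟩ := hVt V V.2
    ⟨x, hV.trans hx.symm.subset⟩
  choose z hz using hcenter
  obtain ⟨φ, hφ⟩ := PartitionOfUnity.exists_isSubordinate isClosed_univ
    (fun V : 𝒱 ↦ (V : Set K)) (fun V ↦ hVopen V V.2) (by rw [← sUnion_eq_iUnion, hVcov])
  have hmem {V : 𝒱} {x : K} (hx : φ V x ≠ 0) : x ∈ (V : Set K) := hφ V (subset_tsupport _ hx)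
  refine ⟨𝒱, hfin.to_subtype, φ, fun V ↦ g (z V), fun V x hx ↦ ?_, fun x ↦ ?_⟩
  · rw [dist_comm]
    exact hz V (hmem hx)
  · refine (encard_le_encard_of_injOn (fun V hV ↦ ?_) Subtype.val_injective.injOn).trans (hcard x)
    exact ⟨V.2, hmem hV⟩

theorem exists_forall_ne_zero {E : Type*} [NormedAddCommGroup E] [NormedSpace ℝ E]
    [FiniteDimensional ℝ E] (h : HasCoveringDimensionLT n K) (hn : n ≤ Module.finrank ℝ E)
    (g : C(K, E)) {ε : ℝ} (hε : 0 < ε) :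
    ∃ f : C(K, E), (∀ x, dist (f x) (g x) < ε) ∧ ∀ x, f x ≠ 0 := by
  obtain ⟨ι, _, φ, q, hq, hcard⟩ := h.exists_partitionOfUnity g (half_pos hε)
  have := Fintype.ofFinite ι
  obtain ⟨p, hpq, hp⟩ := exists_dist_lt_linearIndepOn q (half_pos hε) Finset.univ
  refine ⟨⟨fun x ↦ ∑ᶠ i, φ i x • p i,
    φ.continuous_finsum_smul fun i x _ ↦ continuousAt_const⟩, fun x ↦ ?_, fun x hx ↦ ?_⟩
  · refine φ.finsum_smul_mem_convex (g := fun i _ ↦ p i) (mem_univ x) (fun i hi ↦ ?_)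
      (convex_ball (g x) ε)
    rw [Metric.mem_ball]
    linarith [dist_triangle (p i) (q i) (g x), hpq i, hq i x hi]
  · -- A zero would be a nontrivial relation among the at most `n` vectors `p i` with `φ i x ≠ 0`.
    obtain ⟨i, hi⟩ := φ.exists_pos (mem_univ x)
    let T : Finset ι := {i | φ i x ≠ 0}
    have hT : (T : Set ι) = {i | φ i x ≠ 0} := Finset.coe_filter_univ _
    have hTcard : T.card ≤ n := by
      have := hcard x
      rwa [← hT, encard_coe_eq_coe_finsetCard, Nat.cast_le] at this
    have hsum : ∑ i ∈ T, φ i x • p i = 0 := by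
      rw [← hx]
      refine (finsum_eq_sum_of_support_subset _ ?_).symm
      rw [hT]
      exact Function.support_smul_subset_left _ _
    exact hi.ne' (linearIndepOn_finset_iff.1 (hp T (Finset.subset_univ _) (hTcard.trans hn))
      (fun i ↦ φ i x) hsum i (Finset.mem_filter_univ _ |>.2 hi.ne'))

end HasCoveringDimensionLT

open scoped BoundedContinuousFunction

theorem isOpen_setOf_forall_exists_add_ne_zero {ι K : Type*} [TopologicalSpace ι]
    [TopologicalSpace K] [CompactSpace K] (g : ι → C(K, ℝ)) (s : Finset ι) :
    IsOpen {F : (ι × K) →ᵇ ℝ | ∀ x, ∃ i ∈ s, g i x + F (i, x) ≠ 0} := by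
  have hclosed : IsClosed
      (⋂ i ∈ s, {q : K × ((ι × K) →ᵇ ℝ) | g i q.1 + q.2 (i, q.1) = 0}) := by
    refine isClosed_biInter fun i _ ↦ isClosed_eq (.add (by fun_prop) ?_) continuous_const
    exact continuous_eval.comp (continuous_snd.prodMk (continuous_const.prodMk continuous_fst))
  rw [← isClosed_compl_iff]
  convert isClosedMap_snd_of_compactSpace _ hclosed
  ext F
  simp

namespace HasCoveringDimensionLT

theorem dense_setOf_forall_exists_add_ne_zero {ι : Type*} [TopologicalSpace ι]
    [DiscreteTopology ι] (h : HasCoveringDimensionLT n K) (g : ι → C(K, ℝ)) {s : Finset ι}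
    (hs : n ≤ s.card) :
    Dense {F : (ι × K) →ᵇ ℝ | ∀ x, ∃ i ∈ s, g i x + F (i, x) ≠ 0} := by
  classical
  rw [Metric.dense_iff]
  intro F r hr
  let G : C(K, s → ℝ) := ⟨fun x i ↦ g i x + F (i, x), by fun_prop⟩
  obtain ⟨f, hfG, hf⟩ := h.exists_forall_ne_zero (by simpa using hs) G (half_pos hr)
  let Δ : ι × K → ℝ := fun q ↦ if hq : q.1 ∈ s then f q.2 ⟨q.1, hq⟩ - G q.2 ⟨q.1, hq⟩ else 0
  have hΔ : Continuous Δ := continuous_prod_of_discrete_left.2 fun i ↦ by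
    by_cases hi : i ∈ s
    · simp only [Δ, hi, ↓reduceDIte]
      exact ((continuous_apply (⟨i, hi⟩ : s)).comp (f - G).continuous)
    · simp only [Δ, hi, ↓reduceDIte, continuous_const]
  have hΔle (q : ι × K) : ‖Δ q‖ ≤ r / 2 := by
    by_cases hq : q.1 ∈ s
    · simp only [Δ, hq, ↓reduceDIte]
      exact (dist_le_pi_dist (f q.2) (G q.2) ⟨q.1, hq⟩).trans (hfG q.2).le
    · simp only [Δ, hq, ↓reduceDIte, norm_zero, (half_pos hr).le]
  refine ⟨F + .ofNormedAddCommGroup Δ hΔ _ hΔle, ?_, fun x ↦ ?_⟩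
  · rw [mem_ball_iff_norm, add_sub_cancel_left]
    exact (BoundedContinuousFunction.norm_ofNormedAddCommGroup_le _ (half_pos hr).le
      hΔle).trans_lt (half_lt_self hr)
  · obtain ⟨i, hi⟩ := Function.ne_iff.1 (hf x)
    have hadd : g i x + (F + .ofNormedAddCommGroup Δ hΔ _ hΔle) (i, x) = f x i := by
      simp only [BoundedContinuousFunction.add_apply,
        BoundedContinuousFunction.coe_ofNormedAddCommGroup, Δ, G, i.2, ↓reduceDIte,
        ContinuousMap.coe_mk]
      ring
    exact ⟨i, i.2, hadd ▸ hi⟩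

theorem exists_encard_zero_lt {ι : Type*} [Countable ι] (h : HasCoveringDimensionLT n K)
    (g : ι → C(K, ℝ)) {ε : ℝ} (hε : 0 < ε) :
    ∃ f : ι → C(K, ℝ), (∀ i x, |f i x - g i x| < ε) ∧ ∀ x, {i | f i x = 0}.encard < n := by
  let : TopologicalSpace ι := ⊥
  have : DiscreteTopology ι := ⟨rfl⟩
  obtain ⟨F, hF, hFne⟩ := Metric.dense_iff.1 (dense_iInter_of_isOpen
    (fun s : {s : Finset ι // n ≤ s.card} ↦ isOpen_setOf_forall_exists_add_ne_zero g s.1)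
    fun s ↦ h.dense_setOf_forall_exists_add_ne_zero g s.2) 0 ε hε
  refine ⟨fun i ↦ g i + ⟨fun x ↦ F (i, x), by fun_prop⟩, fun i x ↦ ?_, fun x ↦ ?_⟩
  · rw [mem_ball_zero_iff] at hF
    simpa using (F.norm_coe_le_norm (i, x)).trans_lt hF
  · by_contra! hle
    obtain ⟨t, ht, htcard⟩ := exists_subset_encard_eq hle
    lift t to Finset ι using finite_of_encard_eq_coe htcard
    rw [encard_coe_eq_coe_finsetCard, Nat.cast_inj] at htcard
    obtain ⟨i, hi, hne⟩ := mem_iInter.1 hFne ⟨t, htcard.ge⟩ x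
    exact hne (ht hi)

theorem exists_separating_encard_zero_lt {ι : Type*} [Countable ι]
    (h : HasCoveringDimensionLT n K) {A B : ι → Set K} (hA : ∀ i, IsClosed (A i))
    (hB : ∀ i, IsClosed (B i)) (hAB : ∀ i, Disjoint (A i) (B i)) :
    ∃ f : ι → C(K, ℝ), (∀ i, ∀ x ∈ A i, f i x < 0) ∧ (∀ i, ∀ x ∈ B i, 0 < f i x) ∧
      ∀ x, {i | f i x = 0}.encard < n := by
  choose g hgA hgB _ using fun i ↦ exists_continuous_zero_one_of_isClosed (hA i) (hB i) (hAB i)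
  obtain ⟨f, hfg, hf⟩ := h.exists_encard_zero_lt
    (fun i ↦ g i - ContinuousMap.const K (1 / 2)) one_half_pos
  refine ⟨f, fun i x hx ↦ ?_, fun i x hx ↦ ?_, hf⟩
  · have hlt := hfg i x
    simp only [ContinuousMap.sub_apply, ContinuousMap.const_apply, hgA i hx, Pi.zero_apply] at hlt
    linarith [(abs_lt.1 hlt).2]
  · have hlt := hfg i x
    simp only [ContinuousMap.sub_apply, ContinuousMap.const_apply, hgB i hx, Pi.one_apply] at hlt
    linarith [(abs_lt.1 hlt).1]

end HasCoveringDimensionLT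

namespace StronglyZeroDimensional

variable {X ι : Type*} [TopologicalSpace X]

theorem of_forall_exists_continuous {W : Set X} [LindelofSpace W]
    (h : ∀ x ∈ W, ∀ U ∈ 𝓝 x, ∃ f : C(X, ℝ), f x < 0 ∧ (∀ y ∉ U, 0 ≤ f y) ∧ ∀ y ∈ W, f y ≠ 0) :
    StronglyZeroDimensional W := by
  refine of_isTopologicalBasis_isClopen
    (isTopologicalBasis_of_isOpen_of_nhds (fun C hC ↦ hC.isOpen) fun x V hx hV ↦ ?_)
  obtain ⟨U, hU, rfl⟩ := isOpen_induced_iff.1 hV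
  obtain ⟨f, hfx, hfU, hfW⟩ := h x x.2 U (hU.mem_nhds hx)
  have hf : Continuous fun y : W ↦ f y := by fun_prop
  have hle : {y : W | f y < 0} = {y : W | f y ≤ 0} :=
    Set.ext fun y ↦ (hfW y y.2).le_iff_lt.symm
  exact ⟨{y : W | f y < 0}, ⟨hle ▸ isClosed_le hf continuous_const, isOpen_lt hf continuous_const⟩,
    hfx, fun y hy ↦ by_contra fun hyU ↦ (hfU y hyU).not_gt hy⟩

theorem setOf_encard_zero_eq [T3Space X] [SecondCountableTopology X] [Countable ι]
    {f : ι → C(X, ℝ)} (hf : ∀ x, ∀ U ∈ 𝓝 x, {i | f i x < 0 ∧ ∀ y ∉ U, 0 ≤ f i y}.Infinite)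
    (j : ℕ) : StronglyZeroDimensional {x | {i | f i x = 0}.encard = j} := by
  let T := {t : Finset ι // t.card = j}
  refine of_subset_iUnion (F := fun t : T ↦ {x | ∀ i ∈ t.1, f i x = 0}) (fun t ↦ ?_) ?_ ?_
  · simp only [ofPred_forall]
    exact isClosed_biInter fun i _ ↦ isClosed_eq (f i).continuous continuous_const
  · rintro x (hx : {i | f i x = 0}.encard = j)
    have hfin := finite_of_encard_eq_coe hx
    rw [hfin.encard_eq_coe_toFinset_card, Nat.cast_inj] at hx
    exact mem_iUnion.2 ⟨⟨hfin.toFinset, hx⟩, fun i hi ↦ hfin.mem_toFinset.1 hi⟩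
  · rintro ⟨t, ht⟩
    refine of_forall_exists_continuous fun x _ U hU ↦ ?_
    -- Where all of `t` vanishes and only `j = t.card` functions do, no `f i` with `i ∉ t` vanishes.
    obtain ⟨i, ⟨hix, hiU⟩, hit⟩ := (hf x U hU).exists_notMem_finset t
    refine ⟨f i, hix, hiU, fun y ⟨hy, hyt⟩ hiy ↦ hit ?_⟩
    have hzero : (t : Set ι) = {i | f i y = 0} :=
      t.finite_toSet.eq_of_subset_of_encard_le hyt (by
        rw [encard_coe_eq_coe_finsetCard, ht]
        exact hy.le)
    exact Finset.mem_coe.1 (hzero ▸ hiy)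

end StronglyZeroDimensional

theorem HasCoveringDimensionLT.hasZeroDimensionalCover [SecondCountableTopology K]
    (h : HasCoveringDimensionLT n K) : HasZeroDimensionalCover n K := by
  have := (countable_countableBasis K).to_subtype
  have hbasis := isBasis_countableBasis K
  let P := {p : countableBasis K × countableBasis K // closure (p.1 : Set K) ⊆ p.2}
  -- The factor `ℕ` repeats each pair infinitely often, as `setOf_encard_zero_eq` requires.
  obtain ⟨f, hneg, hpos, hcard⟩ := h.exists_separating_encard_zero_lt
    (A := fun i : ℕ × P ↦ closure (i.2.1.1 : Set K)) (B := fun i ↦ (i.2.1.2 : Set K)ᶜ)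
    (fun i ↦ isClosed_closure) (fun i ↦ (hbasis.isOpen i.2.1.2.2).isClosed_compl)
    fun i ↦ disjoint_compl_right_iff_subset.2 i.2.2
  refine ⟨fun j ↦ {x | {i | f i x = 0}.encard = (j : ℕ)}, fun j ↦ .setOf_encard_zero_eq ?_ j,
    iUnion_eq_univ_iff.2 fun x ↦ ?_⟩
  · intro x U hU
    obtain ⟨V, hV, hxV, hVU⟩ := hbasis.mem_nhds_iff.1 hU
    obtain ⟨V', hV', hxV', hVV'⟩ := hbasis.exists_closure_subset ((hbasis.isOpen hV).mem_nhds hxV)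
    let p : P := ⟨(⟨V', hV'⟩, ⟨V, hV⟩), hVV'⟩
    exact infinite_of_injective_forall_mem (f := fun m : ℕ ↦ (m, p))
      (fun m m' hmm' ↦ congrArg Prod.fst hmm') fun m ↦
        ⟨hneg (m, p) x (subset_closure hxV'), fun y hy ↦ (hpos (m, p) y fun hyV ↦ hy (hVU hyV)).le⟩
  · obtain ⟨j, hj⟩ := ENat.ne_top_iff_exists.1 (hcard x).ne_top
    have hjn : j < n := by
      have := hcard x
      rwa [← hj, Nat.cast_lt] at this
    exact ⟨⟨j, hjn⟩, hj.symm⟩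

end CoveringDimension

/-! ### Locally compact spaces -/

theorem exists_isSigmaCompact_forall_nonempty_inter_subset {X ι : Type*} [TopologicalSpace X]
    {v K : ι → Set X} (hv : LocallyFinite v) (hK : ∀ i, IsCompact (K i)) (hvK : ∀ i, v i ⊆ K i)
    (x : X) : ∃ M, IsSigmaCompact M ∧ x ∈ M ∧ ∀ i, (v i ∩ M).Nonempty → v i ⊆ M := by
  let M : ℕ → Set X := fun m ↦ Nat.rec {x} (fun _ M ↦ ⋃ i ∈ {i | (v i ∩ M).Nonempty}, K i) m
  have hM (m : ℕ) : IsCompact (M m) := by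
    induction m with
    | zero => exact isCompact_singleton
    | succ m ih => exact (hv.finite_nonempty_inter_compact ih).isCompact_biUnion fun i _ ↦ hK i
  refine ⟨⋃ m, M m, isSigmaCompact_iUnion_of_isCompact M hM, mem_iUnion.2 ⟨0, rfl⟩, ?_⟩
  rintro i ⟨y, hyi, hyM⟩
  obtain ⟨m, hm⟩ := mem_iUnion.1 hyM
  exact (hvK i).trans ((subset_biUnion_of_mem (u := K) (show i ∈ {i | (v i ∩ M m).Nonempty} from
    ⟨y, hyi, hm⟩)).trans (subset_iUnion M (m + 1)))

theorem exists_isLocallyConstant_isSigmaCompact_fiber (X : Type u) [TopologicalSpace X]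
    [ParacompactSpace X] [WeaklyLocallyCompactSpace X] :
    ∃ (ι : Type u) (p : X → ι), IsLocallyConstant p ∧ ∀ i, IsSigmaCompact (p ⁻¹' {i}) := by
  choose K hK hKx using fun x : X ↦ exists_compact_mem_nhds x
  obtain ⟨v, hv, hvcov, hvfin, hvK⟩ := precise_refinement (fun x ↦ interior (K x))
    (fun x ↦ isOpen_interior)
    (iUnion_eq_univ_iff.2 fun x ↦ ⟨x, mem_interior_iff_mem_nhds.2 (hKx x)⟩)
  let r : X → X → Prop := fun x y ↦ ∃ i, x ∈ v i ∧ y ∈ v i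
  have hp : IsLocallyConstant (Quot.mk r) := by
    refine (IsLocallyConstant.iff_exists_open _).2 fun x ↦ ?_
    obtain ⟨i, hi⟩ := iUnion_eq_univ_iff.1 hvcov x
    exact ⟨v i, hv i, hi, fun y hy ↦ Quot.sound ⟨i, hy, hi⟩⟩
  refine ⟨Quot r, Quot.mk r, hp, Quot.ind fun x ↦ ?_⟩
  obtain ⟨M, hM, hxM, hvM⟩ := exists_isSigmaCompact_forall_nonempty_inter_subset hvfin hK
    (fun i ↦ (hvK i).trans interior_subset) x
  have hinv (y z : X) : r y z → (y ∈ M) = (z ∈ M) := fun ⟨i, hy, hz⟩ ↦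
    propext ⟨fun hyM ↦ hvM i ⟨y, hy, hyM⟩ hz, fun hzM ↦ hvM i ⟨z, hz, hzM⟩ hy⟩
  refine hM.of_isClosed_subset (hp.isClosed_fiber _) fun y hy ↦ ?_
  have hyx : (y ∈ M) = (x ∈ M) := congrArg (Quot.lift (· ∈ M) hinv) hy
  exact hyx.mpr hxM

namespace HasZeroDimensionalCover

variable {X ι : Type*} [TopologicalSpace X] {n : ℕ}

theorem of_isLocallyConstant {p : X → ι} (hp : IsLocallyConstant p)
    (h : ∀ i, HasZeroDimensionalCover n (p ⁻¹' {i})) : HasZeroDimensionalCover n X := by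
  choose Z hZ hcov using h
  refine ⟨fun j ↦ ⋃ i, Subtype.val '' Z i j, fun j ↦ .of_isLocallyConstant
    (hp.comp_continuous continuous_subtype_val) fun i ↦ .preimage_val (F := p ⁻¹' {i}) ?_,
    iUnion_eq_univ_iff.2 fun x ↦ ?_⟩
  · have hfiber : (⋃ i, Subtype.val '' Z i j) ∩ p ⁻¹' {i} = Subtype.val '' Z i j := by
      refine Subset.antisymm ?_ fun x hx ↦ ⟨mem_iUnion.2 ⟨i, hx⟩, Subtype.coe_image_subset _ _ hx⟩
      rintro _ ⟨hx, hxi⟩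
      obtain ⟨i', y, hy, rfl⟩ := mem_iUnion.1 hx
      obtain rfl : i' = i := y.2.symm.trans hxi
      exact ⟨y, hy, rfl⟩
    rw [hfiber, StronglyZeroDimensional.image_iff .subtypeVal]
    exact hZ i j
  · obtain ⟨j, hj⟩ := iUnion_eq_univ_iff.1 (hcov (p x)) ⟨x, rfl⟩
    exact ⟨j, mem_iUnion.2 ⟨p x, _, hj, rfl⟩⟩

variable [MetrizableSpace X]

theorem of_forall_isCompact_of_sigmaCompactSpace [SigmaCompactSpace X]
    (h : ∀ K : Set X, IsCompact K → HasZeroDimensionalCover n K) : HasZeroDimensionalCover n X :=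
  of_iUnion (fun m ↦ (isCompact_compactCovering X m).isClosed) (iUnion_compactCovering X)
    fun m ↦ h _ (isCompact_compactCovering X m)

theorem of_forall_isCompact [WeaklyLocallyCompactSpace X]
    (h : ∀ K : Set X, IsCompact K → HasZeroDimensionalCover n K) :
    HasZeroDimensionalCover n X := by
  let := metrizableSpaceMetric X
  obtain ⟨ι, p, hp, hσ⟩ := exists_isLocallyConstant_isSigmaCompact_fiber X
  refine of_isLocallyConstant hp fun i ↦ ?_
  have := isSigmaCompact_iff_sigmaCompactSpace.1 (hσ i)
  refine of_forall_isCompact_of_sigmaCompactSpace fun K hK ↦ ?_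
  exact (h _ (hK.image continuous_subtype_val)).of_isEmbedding
    (IsEmbedding.subtypeVal.homeomorphImage K).isEmbedding

end HasZeroDimensionalCover

/-! ### Separators in compact spaces -/

theorem exists_isOpen_frontier_subset_sUnion {X : Type*} [TopologicalSpace X] [CompactSpace X]
    {x : X} {V : Set X} (hV : IsOpen V) {𝓛 : Set (Set X)}
    (h : ∀ y ∉ V, ∃ L ∈ 𝓛, IsClosedSeparator L x y) :
    ∃ U, IsOpen U ∧ x ∈ U ∧ U ⊆ V ∧ ∃ t ⊆ 𝓛, t.Finite ∧ frontier U ⊆ ⋃₀ t := by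
  choose L h𝓛 _ A B hA hB hAB hABL hxA hyB using fun y : ↥Vᶜ ↦ h y y.2
  obtain ⟨t, ht⟩ := hV.isClosed_compl.isCompact.elim_finite_subcover B hB
    fun y hy ↦ mem_iUnion.2 ⟨⟨y, hy⟩, hyB ⟨y, hy⟩⟩
  refine ⟨⋂ y ∈ t, A y, isOpen_biInter_finset fun y _ ↦ hA y, mem_iInter₂.2 fun y _ ↦ hxA y,
    fun z hz ↦ ?_, L '' t, image_subset_iff.2 fun y _ ↦ h𝓛 y, t.finite_toSet.image L,
    fun z hz ↦ ?_⟩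
  · by_contra hzV
    obtain ⟨y, hyt, hzB⟩ := mem_iUnion₂.1 (ht hzV)
    exact disjoint_left.1 (hAB y) (mem_iInter₂.1 hz y hyt) hzB
  · rw [(isOpen_biInter_finset fun y _ ↦ hA y).frontier_eq] at hz
    obtain ⟨y, hyt, hzA⟩ : ∃ y ∈ t, z ∉ A y := by
      simpa only [mem_iInter, not_forall, exists_prop] using hz.2
    have hzB : z ∉ B y :=
      disjoint_left.1 ((hAB y).closure_left (hB y)) (closure_mono (biInter_subset_of_mem hyt) hz.1)
    exact ⟨L y, mem_image_of_mem L hyt,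
      not_not.1 fun hzL ↦ (hABL y ▸ hzL : z ∈ A y ∪ B y).elim hzA hzB⟩

namespace HasZeroDimensionalCover

theorem of_forall_isClosedSeparator {X : Type*} [TopologicalSpace X] [CompactSpace X] [T3Space X]
    [SecondCountableTopology X] {n : ℕ}
    (h : ∀ x y : X, x ≠ y → ∃ L : Set X, IsClosedSeparator L x y ∧ HasZeroDimensionalCover n L) :
    HasZeroDimensionalCover (n + 1) X := by
  refine .of_hasSmallInductiveDimensionLT (.succ n
    {U | IsOpen U ∧ HasSmallInductiveDimensionLT (frontier U) n}
    (isTopologicalBasis_of_isOpen_of_nhds (fun U hU ↦ hU.1) fun x V hx hV ↦ ?_) fun U hU ↦ hU.2)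
  obtain ⟨U, hU, hxU, hUV, t, ht, htfin, hUt⟩ := exists_isOpen_frontier_subset_sUnion hV
    (𝓛 := {L | IsClosed L ∧ HasZeroDimensionalCover n L})
    fun y hy ↦ let ⟨L, hL, hcover⟩ := h x y (ne_of_mem_of_not_mem hx hy)
    ⟨L, ⟨hL.1, hcover⟩, hL⟩
  have := htfin.countable.to_subtype
  have hfrontier : HasZeroDimensionalCover n (frontier U) :=
    of_subset_iUnion (F := fun L : t ↦ (L : Set X)) (fun L ↦ (ht L.2).1)
      (by rwa [← sUnion_eq_iUnion]) fun L ↦ (ht L.2).2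
  exact ⟨U, ⟨hU, hfrontier.hasLargeInductiveDimensionLT.hasSmallInductiveDimensionLT⟩, hxU, hUV⟩

end HasZeroDimensionalCover

theorem IsClosedSeparator.preimage {X Y : Type*} [TopologicalSpace X] [TopologicalSpace Y]
    {f : Y → X} (hf : Continuous f) {L : Set X} {x y : Y} (h : IsClosedSeparator L (f x) (f y)) :
    IsClosedSeparator (f ⁻¹' L) x y :=
  let ⟨hL, U, V, hU, hV, hUV, hUVL, hx, hy⟩ := h
  ⟨hL.preimage hf, f ⁻¹' U, f ⁻¹' V, hU.preimage hf, hV.preimage hf, hUV.preimage f,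
    by rw [← preimage_union, hUVL, preimage_compl], hx, hy⟩

/-! ### The dimension functions -/

section Arithmetic

theorem exists_lt_natCast_le {a b : WithBot ℕ∞} (h : a < b) : ∃ n : ℕ, a < n ∧ n ≤ b := by
  induction a using WithBot.recBotCoe with
  | bot => exact ⟨0, WithBot.bot_lt_coe _, not_lt.1 fun hb ↦ h.ne' (WithBot.lt_coe_bot.1 hb)⟩
  | coe a =>
    lift a to ℕ using (WithBot.coe_lt_coe.1 (h.trans_le le_top)).ne
    exact ⟨a + 1, by exact_mod_cast a.lt_succ_self,
      by exact_mod_cast ENat.WithBot.add_one_le_iff.2 h⟩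

theorem eq_of_forall_lt_natCast_iff {a b : WithBot ℕ∞} (h : ∀ n : ℕ, a < n ↔ b < n) : a = b := by
  refine eq_of_le_of_not_lt (not_lt.1 fun hba ↦ ?_) fun hab ↦ ?_
  · obtain ⟨n, hbn, hna⟩ := exists_lt_natCast_le hba
    exact ((h n).2 hbn).not_ge hna
  · obtain ⟨n, han, hnb⟩ := exists_lt_natCast_le hab
    exact ((h n).1 han).not_ge hnb

theorem iSup_lt_natCast_iff {ι : Sort*} {f : ι → WithBot ℕ∞} {n : ℕ} :
    ⨆ i, f i < n ↔ ∀ i, f i < n := by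
  refine ⟨fun h i ↦ (le_iSup f i).trans_lt h, fun h ↦ ?_⟩
  cases n with
  | zero => exact WithBot.lt_coe_bot.2 (iSup_eq_bot.2 fun i ↦ WithBot.lt_coe_bot.1 (h i))
  | succ n =>
    simp only [Nat.cast_succ, ENat.WithBot.lt_add_one_iff] at h ⊢
    exact iSup_le h

theorem sInf_setOf_forall_lt_natCast_lt_iff {P : ℕ → Prop} (hP : Monotone P) {n : ℕ} :
    sInf {m : WithBot ℕ∞ | ∀ i : ℕ, m < i → P i} < n ↔ P n := by
  refine ⟨fun h ↦ ?_, fun h ↦ ?_⟩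
  · obtain ⟨m, hm, hmn⟩ := sInf_lt_iff.1 h
    exact hm n hmn
  · cases n with
    | zero =>
      have hbot : (⊥ : WithBot ℕ∞) ∈ {m : WithBot ℕ∞ | ∀ i : ℕ, m < i → P i} :=
        fun i _ ↦ hP (Nat.zero_le i) h
      exact (sInf_le hbot).trans_lt (WithBot.bot_lt_coe _)
    | succ n =>
      rw [Nat.cast_succ, ENat.WithBot.lt_add_one_iff]
      exact sInf_le fun i hi ↦ hP (by exact_mod_cast hi) h

end Arithmetic

section DimensionFunctions

variable {X : Type u} [TopologicalSpace X] {n : ℕ}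

theorem HasLargeInductiveDimensionLT.succ (h : HasLargeInductiveDimensionLT n X) :
    HasLargeInductiveDimensionLT (n + 1) X := by
  induction n generalizing X with
  | zero =>
    have : IsEmpty X := h
    exact fun A V _ hV hAV ↦ ⟨V, hV, hAV, Subset.rfl, ⟨fun x ↦ isEmptyElim x.1⟩⟩
  | succ n ih =>
    intro A V hA hV hAV
    obtain ⟨U, hU, hAU, hUV, hfrontier⟩ := h A V hA hV hAV
    exact ⟨U, hU, hAU, hUV, ih hfrontier⟩

theorem HasCoveringDimensionLT.mono {m : ℕ} (hmn : m ≤ n) (h : HasCoveringDimensionLT m X) :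
    HasCoveringDimensionLT n X := fun 𝒰 hfin hopen hcov ↦
  let ⟨𝒱, h𝒱fin, h𝒱open, h𝒱cov, h𝒱𝒰, hcard⟩ := h 𝒰 hfin hopen hcov
  ⟨𝒱, h𝒱fin, h𝒱open, h𝒱cov, h𝒱𝒰, fun x ↦ (hcard x).trans (Nat.cast_le.2 hmn)⟩

theorem largeInductiveDimension_lt_iff :
    largeInductiveDimension X < n ↔ HasLargeInductiveDimensionLT n X :=
  sInf_setOf_forall_lt_natCast_lt_iff (P := fun n ↦ HasLargeInductiveDimensionLT n X)
    (monotone_nat_of_le_succ fun _ ↦ .succ)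

theorem coveringDimension_lt_iff : coveringDimension X < n ↔ HasCoveringDimensionLT n X :=
  sInf_setOf_forall_lt_natCast_lt_iff (P := fun n ↦ HasCoveringDimensionLT n X) fun _ _ ↦ .mono

theorem indHat_lt_iff : indHat X < n ↔
    ∀ S : Set X, LocallyCompactSpace S → HasSmallInductiveDimensionLT S n := by
  simp only [indHat, iSup_lt_natCast_iff, smallInductiveDimension_lt_iff]

theorem largeIndHat_lt_iff : largeIndHat X < n ↔
    ∀ S : Set X, LocallyCompactSpace S → HasLargeInductiveDimensionLT n S := by
  simp only [largeIndHat, iSup_lt_natCast_iff, largeInductiveDimension_lt_iff]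

theorem dimHat_lt_iff : dimHat X < n ↔
    ∀ S : Set X, LocallyCompactSpace S → HasCoveringDimensionLT n S := by
  simp only [dimHat, iSup_lt_natCast_iff, coveringDimension_lt_iff]

end DimensionFunctions

section CompactSubsets

variable {X : Type u} [TopologicalSpace X] {n : ℕ}

theorem HasZeroDimensionalCover.of_indHat_lt {Y : Type*} [TopologicalSpace Y] [CompactSpace Y]
    [MetrizableSpace Y] (h : indHat X < n) {f : Y → X} (hf : IsEmbedding f) :
    HasZeroDimensionalCover n Y := by
  have hrange := hf.toHomeomorph
  have := hrange.compactSpace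
  have := hrange.symm.isEmbedding.metrizableSpace
  exact (of_hasSmallInductiveDimensionLT (indHat_lt_iff.1 h (range f) inferInstance)).of_isEmbedding
    hrange.isEmbedding

theorem HasZeroDimensionalCover.of_forall_isCompact_subset {S : Set X} [MetrizableSpace S]
    [LocallyCompactSpace S]
    (h : ∀ K : Set X, IsCompact K → HasZeroDimensionalCover n K) : HasZeroDimensionalCover n S := by
  refine of_forall_isCompact fun K hK ↦ ?_
  have := isCompact_iff_compactSpace.1 hK
  have himage := IsEmbedding.subtypeVal.homeomorphImage K
  have := himage.symm.isEmbedding.t1Space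
  exact (h _ (hK.image continuous_subtype_val)).of_isEmbedding himage.isEmbedding

variable [T2Space X] (hX : ∀ S : Set X, LocallyCompactSpace S → MetrizableSpace S)

include hX

theorem indHat_lt_iff_forall_isCompact :
    indHat X < n ↔ ∀ K : Set X, IsCompact K → HasZeroDimensionalCover n K := by
  refine ⟨fun h K hK ↦ ?_, fun h ↦ indHat_lt_iff.2 fun S _ ↦ ?_⟩
  · have := isCompact_iff_compactSpace.1 hK
    have := hX K inferInstance
    exact .of_indHat_lt h .subtypeVal
  · have := hX S inferInstance
    exact (HasZeroDimensionalCover.of_forall_isCompact_subset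
      h).hasLargeInductiveDimensionLT.hasSmallInductiveDimensionLT

theorem largeIndHat_lt_iff_forall_isCompact :
    largeIndHat X < n ↔ ∀ K : Set X, IsCompact K → HasZeroDimensionalCover n K := by
  refine ⟨fun h K hK ↦ ?_, fun h ↦ largeIndHat_lt_iff.2 fun S _ ↦ ?_⟩
  · have := isCompact_iff_compactSpace.1 hK
    have := hX K inferInstance
    exact .of_hasSmallInductiveDimensionLT
      (largeIndHat_lt_iff.1 h K inferInstance).hasSmallInductiveDimensionLT
  · have := hX S inferInstance
    exact (HasZeroDimensionalCover.of_forall_isCompact_subset h).hasLargeInductiveDimensionLT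

theorem dimHat_lt_iff_forall_isCompact :
    dimHat X < n ↔ ∀ K : Set X, IsCompact K → HasZeroDimensionalCover n K := by
  refine ⟨fun h K hK ↦ ?_, fun h ↦ dimHat_lt_iff.2 fun S _ ↦ ?_⟩
  · have := isCompact_iff_compactSpace.1 hK
    have := hX K inferInstance
    exact (dimHat_lt_iff.1 h K inferInstance).hasZeroDimensionalCover
  · have := hX S inferInstance
    exact (HasZeroDimensionalCover.of_forall_isCompact_subset h).hasCoveringDimensionLT

end CompactSubsets

theorem mainTheorem8_general {X : Type*} [TopologicalSpace X]
    (hX : ∀ S : Set X, LocallyCompactSpace S → MetrizableSpace S) (D : ℕ)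
    (hsep : ∀ x y : X, x ≠ y → ∃ L : Set X, IsClosedSeparator L x y ∧ indHat L < D) :
    indHat X = largeIndHat X ∧ largeIndHat X = dimHat X ∧ dimHat X ≤ D := by
  have : T2Space X := ⟨fun x y hxy ↦
    let ⟨_, ⟨_, U, V, hU, hV, hUV, _, hx, hy⟩, _⟩ := hsep x y hxy
    ⟨U, V, hU, hV, hx, hy, hUV⟩⟩
  refine ⟨eq_of_forall_lt_natCast_iff fun n ↦ ?_, eq_of_forall_lt_natCast_iff fun n ↦ ?_, ?_⟩
  · rw [indHat_lt_iff_forall_isCompact hX, largeIndHat_lt_iff_forall_isCompact hX]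
  · rw [largeIndHat_lt_iff_forall_isCompact hX, dimHat_lt_iff_forall_isCompact hX]
  · rw [← ENat.WithBot.lt_add_one_iff, ← Nat.cast_succ, dimHat_lt_iff_forall_isCompact hX]
    intro K hK
    have := isCompact_iff_compactSpace.1 hK
    have := hX K inferInstance
    refine .of_forall_isClosedSeparator fun x y hxy ↦ ?_
    obtain ⟨L, hL, hdim⟩ := hsep x y (Subtype.val_injective.ne hxy)
    have hLK : IsClosedSeparator (Subtype.val ⁻¹' L) x y := hL.preimage continuous_subtype_val
    have := isCompact_iff_compactSpace.1 hLK.1.isCompact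
    exact ⟨_, hLK, .of_indHat_lt hdim (IsEmbedding.subtypeVal.restrictPreimage L)⟩

/-- The condition `indHat L < D` says that the dimension of `L` is at most `D - 1`; for `D = 0`
this is `-1`, i.e. `L` is empty. -/
theorem mainTheorem8 {X : Type*} [MetricSpace X] (D : ℕ)
    (hsep : ∀ x y : X, x ≠ y → ∃ L : Set X, IsClosedSeparator L x y ∧ indHat L < D) :
    indHat X = largeIndHat X ∧ largeIndHat X = dimHat X ∧ dimHat X ≤ D :=
  mainTheorem8_general (fun _ _ ↦ inferInstance) D hsep
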